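/- Let $d\ge 2$ and let $\Lambda$ be a $d$-cube in $\mathbb{R}^d$ centred at the origin, with faces not necessarily parallel to the coordinate hyperplanes. Regard $\Lambda$ also as the finite graph $(V,E)$ whose vertices are the points of $\mathbb{Z}^d$ in the cube and whose edges join points at Euclidean distance $1$, and put $|\Lambda|=|V|$. Let $\partial\Lambda$ be the set of vertices of $\Lambda$ having a lattice neighbour outside $\Lambda$. A hyperplane through the origin parallel to a face of the cube splits $\Lambda$ in two; let $T$ and $B$ be the disjoint sets of the vertices of $\partial\Lambda$ on its two sides (vertices of $\partial\Lambda$ lying on the hyperplane may be put in $T$, in $B$, or in neither). For $p\in[0,1]$ and $q\ge 1$ let $\Phi^{TB}_{\Lambda,p,q}$ be the random-cluster measure on $\{0,1\}^E$ with $TB$ boundary condition, that is, the probability measure with $$\Phi^{TB}_{\Lambda,p,q}(\omega)\ \propto\ \Big(\prod_{e\in E}p^{\omega(e)}(1-p)^{1-\omega(e)}\Big)\,q^{k(\omega)},$$ where $k(\omega)$ is the number of open clusters (isolated vertices included) counted after all vertices of $T$ have been connected together and all vertices of $B$ have been connected together. Write $T\nleftrightarrow B$ for the event that no open path of $\Lambda$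 joins $T$ to $B$. For a configuration $\omega$, let $\mathcal{P}$ be the set of pivotal edges, i.e. the edges $e\in E$ such that $T$ and $B$ are connected once $e$ is opened. Let $\mathcal{C}$ be the set of cuts of $\omega$, i.e. the inclusion-minimal sets of edges of $\Lambda$ separating $T$ from $B$ in $\Lambda$, all of whose edges are closed in $\omega$. Let $d(\cdot,\cdot)$ denote the Euclidean distance between sets, edges being identified with closed unit segments, and let $\Lambda^c$ be the complement of the cube in $\mathbb{R}^d$. **Proposition.** For any $q\ge 1$ there exist $\tilde p\in(0,1)$ and $\kappa>1$, depending only on $d$ and $q$, such that for every $p\in[\tilde p,1]$, every $c\ge 1$, every cube $\Lambda$ as above with $|\Lambda|>3^{6d}$, and all $T,B$ as above, $$\Phi^{TB}_{\Lambda,p,q}\Big(\exists\, C\in\mathcal{C},\ \exists\, e\in C:\ d\big(e,(\mathcal{P}\setminus\{e\})\cup\Lambda^c\big)\ge \kappa c\ln|\Lambda|\ \Big|\ T\nleftrightarrow B\Big)\ \le\ \frac{1}{|\Lambda|^{c}}.$$ (When $T\nleftrightarrow B$ has probability zero, which can only happen for $p=1$, the conditional probability is taken to be $0$.) -/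

import Mathlib

open scoped ENNReal

/-! ### FK-percolation on a finite graph with two wired vertex sets -/

namespace FK

/-- A percolation configuration on the edges of `G`: `true` is open, `false` is closed. -/
abbrev Config {V : Type*} (G : SimpleGraph V) : Type _ := G.edgeSet → Bool

/-- The graph whose edges are the open edges of `ω`. -/
def openGraph {V : Type*} {G : SimpleGraph V} (ω : Config G) : SimpleGraph V :=
  SimpleGraph.fromEdgeSet {e | ∃ h : e ∈ G.edgeSet, ω ⟨e, h⟩ = true}

/-- The open graph of `ω` in which, moreover, all vertices of `T` are connected together and all
vertices of `B` are connected together. -/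
def wiredGraph {V : Type*} {G : SimpleGraph V} (T B : Set V) (ω : Config G) : SimpleGraph V :=
  openGraph ω ⊔ SimpleGraph.fromRel (fun x y => (x ∈ T ∧ y ∈ T) ∨ (x ∈ B ∧ y ∈ B))

/-- The number of open clusters (isolated vertices included) under the `TB` boundary condition. -/
noncomputable def clusterCount {V : Type*} {G : SimpleGraph V} (T B : Set V) (ω : Config G) : ℕ :=
  Nat.card (wiredGraph T B ω).ConnectedComponent

open Classical in
/-- The unnormalised weight `∏ p^ω(e) (1-p)^(1-ω(e)) * q^k(ω)`. -/
noncomputable def weight {V : Type*} [Fintype V] {G : SimpleGraph V} (T B : Set V) (p q : ℝ)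
    (ω : Config G) : ℝ :=
  (∏ e : G.edgeSet, if ω e = true then p else 1 - p) * q ^ clusterCount T B ω

open Classical in
/-- The partition function of the `TB` boundary condition. -/
noncomputable def partition {V : Type*} [Fintype V] (G : SimpleGraph V) (T B : Set V)
    (p q : ℝ) : ℝ :=
  ∑ ω : Config G, weight T B p q ω

open Classical in
/-- The random-cluster measure on the configurations of `G` with `TB` boundary condition. -/
noncomputable def fkMeasure {V : Type*} [Fintype V] (G : SimpleGraph V) (T B : Set V) (p q : ℝ) :
    MeasureTheory.Measure (Config G) :=
  ∑ ω : Config G,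
    ENNReal.ofReal (weight T B p q ω / partition G T B p q) • MeasureTheory.Measure.dirac ω

/-- Some vertex of `T` is joined to some vertex of `B` by an open path. -/
def Connected {V : Type*} {G : SimpleGraph V} (T B : Set V) (ω : Config G) : Prop :=
  ∃ a ∈ T, ∃ b ∈ B, (openGraph ω).Reachable a b

/-- The event that `T` and `B` are not connected by an open path. -/
def disconnection {V : Type*} (G : SimpleGraph V) (T B : Set V) : Set (Config G) :=
  {ω | ¬ Connected T B ω}

open Classical in
/-- The pivotal edges: the edges whose opening creates a connection between `T` and `B`. -/
def pivotalEdges {V : Type*} {G : SimpleGraph V} (T B : Set V) (ω : Config G) : Set G.edgeSet :=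
  {e | Connected T B (Function.update ω e true)}

/-- The edge set `S` separates the vertex sets `T` and `B` in the graph `G`. -/
def Separates {V : Type*} (G : SimpleGraph V) (T B : Set V) (S : Set G.edgeSet) : Prop :=
  ∀ a ∈ T, ∀ b ∈ B, ¬ (G.deleteEdges (Subtype.val '' S)).Reachable a b

/-- A cut is an inclusion-minimal edge set separating `T` and `B`. -/
def IsCut {V : Type*} (G : SimpleGraph V) (T B : Set V) (S : Set G.edgeSet) : Prop :=
  Minimal (Separates G T B) S

/-- The cuts of the configuration `ω`: the cuts all of whose edges are closed in `ω`. -/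
def cuts {V : Type*} {G : SimpleGraph V} (T B : Set V) (ω : Config G) : Set (Set G.edgeSet) :=
  {S | IsCut G T B S ∧ ∀ e ∈ S, ω e = false}

end FK

/-! ### Boxes in the cubic lattice -/

/-- The point of Euclidean space given by a point of `ℤ^d`. -/
noncomputable def latticePoint {d : ℕ} (x : Fin d → ℤ) : EuclideanSpace ℝ (Fin d) :=
  WithLp.toLp 2 (fun i => (x i : ℝ))

/-- The cubic lattice: the points of `ℤ^d`, joined when at Euclidean distance `1`. -/
def cubicLattice (d : ℕ) : SimpleGraph (Fin d → ℤ) where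
  Adj x y := dist (latticePoint x) (latticePoint y) = 1
  symm := ⟨fun x y h => by rw [dist_comm]; exact h⟩
  loopless := ⟨fun x h => by simp at h⟩

/-- A `d`-cube centred at the origin, not necessarily parallel to the axes: `frame` is a linear
isometry carrying the cube to the straight cube `[-halfSide, halfSide]^d`. -/
structure Box (d : ℕ) where
  frame : EuclideanSpace ℝ (Fin d) ≃ₗᵢ[ℝ] EuclideanSpace ℝ (Fin d)
  halfSide : ℝ
  halfSide_pos : 0 < halfSide

namespace Box

/-- The cube as a subset of Euclidean space. -/
def cube {d : ℕ} (L : Box d) : Set (EuclideanSpace ℝ (Fin d)) :=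
  {x | ∀ i, |L.frame x i| ≤ L.halfSide}

/-- The vertices of the box: the lattice points in the cube. -/
abbrev Vertex {d : ℕ} (L : Box d) : Type := {x : Fin d → ℤ // latticePoint x ∈ L.cube}

theorem finite_vertex {d : ℕ} (L : Box d) : Finite L.Vertex := by
  have hb : ∀ x : Fin d → ℤ, latticePoint x ∈ L.cube →
      ∀ i, |(x i : ℝ)| ≤ Real.sqrt (d * L.halfSide ^ 2) := by
    intro x hx i
    have h1 : ‖latticePoint x‖ ≤ Real.sqrt (d * L.halfSide ^ 2) := by
      rw [← L.frame.norm_map, EuclideanSpace.norm_eq]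
      apply Real.sqrt_le_sqrt
      calc ∑ j, ‖L.frame (latticePoint x) j‖ ^ 2 ≤ ∑ _j : Fin d, L.halfSide ^ 2 :=
            Finset.sum_le_sum fun j _ => pow_le_pow_left₀ (norm_nonneg _) (hx j) 2
        _ = d * L.halfSide ^ 2 := by simp
    exact (PiLp.norm_apply_le (latticePoint x) i).trans h1
  have hf : (Set.univ.pi fun _ : Fin d =>
      Set.Icc (-⌈Real.sqrt (d * L.halfSide ^ 2)⌉) ⌈Real.sqrt (d * L.halfSide ^ 2)⌉).Finite :=
    Set.Finite.pi fun _ => Set.finite_Icc _ _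
  refine Set.Finite.subset hf ?_
  intro x hx i _
  have h := abs_le.mp ((hb x hx i).trans (Int.le_ceil _))
  constructor
  · exact_mod_cast h.1
  · exact_mod_cast h.2

noncomputable instance {d : ℕ} (L : Box d) : Fintype L.Vertex :=
  @Fintype.ofFinite _ L.finite_vertex

/-- The number of vertices of the box. -/
noncomputable def size {d : ℕ} (L : Box d) : ℕ := Fintype.card L.Vertex

/-- The box as a subgraph of the cubic lattice. -/
def graph {d : ℕ} (L : Box d) : SimpleGraph L.Vertex :=
  (cubicLattice d).comap Subtype.val

/-- The vertices of the box with a lattice neighbour outside the box. -/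
def boundary {d : ℕ} (L : Box d) : Set L.Vertex :=
  {x | ∃ y : Fin d → ℤ, latticePoint y ∉ L.cube ∧ (cubicLattice d).Adj x.1 y}

/-- `T` and `B` are the parts of the boundary on the two sides of a hyperplane through the origin
parallel to a face of the cube. They are disjoint; boundary vertices that lie exactly on the
hyperplane may be put in `T`, in `B`, or in neither. -/
def IsTopBottom {d : ℕ} (L : Box d) (T B : Set L.Vertex) : Prop :=
  Disjoint T B ∧ T ⊆ L.boundary ∧ B ⊆ L.boundary ∧
    ∃ i : Fin d,
      (∀ x ∈ L.boundary, 0 < L.frame (latticePoint x.1) i → x ∈ T) ∧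
      (∀ x ∈ L.boundary, L.frame (latticePoint x.1) i < 0 → x ∈ B) ∧
      (∀ x ∈ T, 0 ≤ L.frame (latticePoint x.1) i) ∧
      (∀ x ∈ B, L.frame (latticePoint x.1) i ≤ 0)

/-- The closed unit segment of an edge. -/
def edgeSegment {d : ℕ} (L : Box d) (e : L.graph.edgeSet) : Set (EuclideanSpace ℝ (Fin d)) :=
  convexHull ℝ {z | ∃ x ∈ e.1, z = latticePoint x.1}

/-- The Euclidean distance `inf {dist x y | x ∈ A, y ∈ A'}` between two nonempty sets. -/
noncomputable def setDist {d : ℕ} (A A' : Set (EuclideanSpace ℝ (Fin d))) : ℝ :=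
  sInf (Set.image2 dist A A')

/-- The distance from the edge `e` to the union of the edges in `P` other than `e` and of the
complement of the box. -/
noncomputable def distToPivotalOrOutside {d : ℕ} (L : Box d) (P : Set L.graph.edgeSet)
    (e : L.graph.edgeSet) : ℝ :=
  setDist (L.edgeSegment e) ((⋃ f ∈ P \ {e}, L.edgeSegment f) ∪ L.cubeᶜ)

/-- The event that some edge of some cut of the configuration is at distance at least `r` from
the other pivotal edges and from the complement of the box. -/
def farCutEdge {d : ℕ} (L : Box d) (T B : Set L.Vertex) (r : ℝ) : Set (FK.Config L.graph) :=
  {ω | ∃ C ∈ FK.cuts T B ω, ∃ e ∈ C, r ≤ L.distToPivotalOrOutside (FK.pivotalEdges T B ω) e}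

end Box

/-! A Peierls argument. If an edge e of a closed cut C is far from the other pivotal edges and from
the outside of the cube, a long simple chain of closed, non-pivotal edges of C starts at e
(`Box.exists_isPath_star`). While T and B are disconnected, a non-pivotal edge cannot touch both the
cluster of T and that of B. So, among 2m such edges, m avoid the same cluster and can be opened
together without joining T to B (`exists_subset_openOn_not_connected`).

Opening one closed edge multiplies the weight by at least 1/ε once (1 - p)q ≤ εp, and for a fixed
edge set the opening map is injective. Summing over the possible sets (`sum_weight_le`) bounds the
conditional probability by their number times ε^m. That number is |Λ|d times an exponential in m, so
a small ε and m of order c ln|Λ| suffice.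

The long chain comes from mod 2 cohomology. If the star-component of e in C stayed in a small ball,
its indicator would be a closed cochain of bounded support, hence the coboundary of some F vanishing
outside a slightly larger ball (`exists_coboundary`). Such an F is constant along paths avoiding C
and zero on ∂Λ, so zero on both sides of the cut; yet it must jump by 1 across e. -/

namespace FK

/-! ### Effect of opening edges on the weight, and the Peierls estimate -/

variable {V : Type*} {G : SimpleGraph V}

/-- The walks in a graph to which one edge `uv` is added. -/
theorem reachable_or_of_adj_or {H K : SimpleGraph V} {u v : V}
    (h : ∀ x y, K.Adj x y → H.Adj x y ∨ (x = u ∧ y = v) ∨ (x = v ∧ y = u)) {x y : V}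
    (hxy : K.Reachable x y) :
    H.Reachable x y ∨ (H.Reachable x u ∧ H.Reachable v y) ∨
      (H.Reachable x v ∧ H.Reachable u y) := by
  rw [SimpleGraph.reachable_iff_reflTransGen] at hxy
  induction hxy with
  | refl => exact Or.inl (SimpleGraph.Reachable.refl _)
  | tail _ hstep ih =>
    rcases h _ _ hstep with hs | ⟨rfl, rfl⟩ | ⟨rfl, rfl⟩
    · exact ih.imp (fun h1 => h1.trans hs.reachable)
        (Or.imp (fun h1 => ⟨h1.1, h1.2.trans hs.reachable⟩)
          (fun h1 => ⟨h1.1, h1.2.trans hs.reachable⟩))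
    · rcases ih with h1 | h1 | h1
      · exact Or.inr (Or.inl ⟨h1, SimpleGraph.Reachable.refl _⟩)
      · exact Or.inr (Or.inl ⟨h1.1, SimpleGraph.Reachable.refl _⟩)
      · exact Or.inl h1.1
    · rcases ih with h1 | h1 | h1
      · exact Or.inr (Or.inr ⟨h1, SimpleGraph.Reachable.refl _⟩)
      · exact Or.inl h1.1
      · exact Or.inr (Or.inr ⟨h1.1, SimpleGraph.Reachable.refl _⟩)

/-- Adding one edge to a graph lowers the number of connected components by at most one. -/
theorem card_connectedComponent_le_add_one [Finite V] {H K : SimpleGraph V} {u v : V}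
    (hHK : H ≤ K) (h : ∀ x y, K.Adj x y → H.Adj x y ∨ (x = u ∧ y = v) ∨ (x = v ∧ y = u)) :
    Nat.card H.ConnectedComponent ≤ Nat.card K.ConnectedComponent + 1 := by
  classical
  -- A connection present in K but not in H uses uv, so one of its ends lies in the H-component of
  -- v. Only that component can merge with another; it is sent to `none` below.
  have key : ∀ x y, K.Reachable x y → ¬ H.Reachable x v → ¬ H.Reachable y v →
      H.Reachable x y := by
    intro x y hxy hx hy
    rcases reachable_or_of_adj_or h hxy with h1 | h1 | h1
    · exact h1
    · exact absurd h1.2.symm hy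
    · exact absurd h1.1 hx
  have hinj : Function.Injective (fun c : H.ConnectedComponent =>
      if c = H.connectedComponentMk v then none
      else some (c.map (SimpleGraph.Hom.ofLE hHK))) := by
    intro c c'
    induction c using SimpleGraph.ConnectedComponent.ind with | _ x
    induction c' using SimpleGraph.ConnectedComponent.ind with | _ y
    dsimp only
    split_ifs with h1 h2 h2
    · exact fun _ => h1.trans h2.symm
    · simp
    · simp
    · intro hxy
      rw [SimpleGraph.ConnectedComponent.eq] at h1 h2 ⊢
      refine key x y ?_ h1 h2
      simpa using hxy
  calc Nat.card H.ConnectedComponent ≤ Nat.card (Option K.ConnectedComponent) :=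
        Nat.card_le_card_of_injective _ hinj
    _ = Nat.card K.ConnectedComponent + 1 := by
        rw [Finite.card_option]

theorem openGraph_adj {ω : Config G} {x y : V} :
    (openGraph ω).Adj x y ↔ ∃ h : G.Adj x y, ω ⟨s(x, y), h⟩ = true := by
  simp only [openGraph, SimpleGraph.fromEdgeSet_adj, Set.mem_ofPred_eq]
  exact ⟨fun h => h.1, fun h => ⟨h, h.1.ne⟩⟩

open Classical in
theorem openGraph_update_adj {ω : Config G} {e : G.edgeSet} {x y : V}
    (h : (openGraph (Function.update ω e true)).Adj x y) :
    (openGraph ω).Adj x y ∨ s(x, y) = e.1 := by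
  obtain ⟨hxy, ht⟩ := openGraph_adj.1 h
  by_cases he : (⟨s(x, y), hxy⟩ : G.edgeSet) = e
  · exact Or.inr (congrArg Subtype.val he)
  · rw [Function.update_of_ne he] at ht
    exact Or.inl (openGraph_adj.2 ⟨hxy, ht⟩)

theorem openGraph_mono {ω ω' : Config G} (h : ∀ e, ω e = true → ω' e = true) :
    openGraph ω ≤ openGraph ω' := by
  intro x y hxy
  obtain ⟨h1, h2⟩ := openGraph_adj.1 hxy
  exact openGraph_adj.2 ⟨h1, h _ h2⟩

open Classical in
theorem update_true_of_true {ω : Config G} (e : G.edgeSet) (f : G.edgeSet) (h : ω f = true) :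
    Function.update ω e true f = true := by
  by_cases hf : f = e
  · subst hf; simp
  · rwa [Function.update_of_ne hf]

open Classical in
theorem clusterCount_le_update [Finite V] (T B : Set V) (ω : Config G) (e : G.edgeSet) :
    clusterCount T B ω ≤ clusterCount T B (Function.update ω e true) + 1 := by
  obtain ⟨⟨u, v⟩, he⟩ := e
  refine card_connectedComponent_le_add_one (u := u) (v := v)
    (sup_le_sup_right (openGraph_mono (update_true_of_true _)) _) ?_
  intro x y hxy
  rcases hxy with hxy | hxy
  · rcases openGraph_update_adj hxy with h | h
    · exact Or.inl (Or.inl h)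
    · exact Or.inr (Sym2.eq_iff.1 h)
  · exact Or.inl (Or.inr hxy)

open Classical in
/-- The configuration `ω` in which the edges of `Γ` are opened. -/
noncomputable def openOn (Γ : Finset G.edgeSet) (ω : Config G) : Config G :=
  fun e => if e ∈ Γ then true else ω e

theorem weight_nonneg [Fintype V] (T B : Set V) {p q : ℝ} (hp0 : 0 ≤ p) (hp1 : p ≤ 1)
    (hq : 0 ≤ q) (ω : Config G) : 0 ≤ weight T B p q ω := by
  refine mul_nonneg (Finset.prod_nonneg fun e _ => ?_) (pow_nonneg hq _)
  split_ifs
  · exact hp0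
  · linarith

open Classical in
-- The edge factor goes from 1 - p to p, and at most one cluster is lost, which costs a factor at
-- most q because q ≥ 1.
theorem weight_le_update [Fintype V] (T B : Set V) {p q ε : ℝ} (hp0 : 0 ≤ p) (hp1 : p ≤ 1)
    (hq : 1 ≤ q) (hε : (1 - p) * q ≤ ε * p) (ω : Config G) (e : G.edgeSet)
    (he : ω e = false) :
    weight T B p q ω ≤ ε * weight T B p q (Function.update ω e true) := by
  have hR : ∀ ω' : Config G, (∏ f : G.edgeSet, if ω' f = true then p else 1 - p)
      = (if ω' e = true then p else 1 - p) *
        ∏ f ∈ Finset.univ.erase e, if ω' f = true then p else 1 - p := fun ω' =>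
    (Finset.mul_prod_erase _ _ (Finset.mem_univ e)).symm
  have hsame : (∏ f ∈ Finset.univ.erase e,
        if Function.update ω e true f = true then p else 1 - p)
      = ∏ f ∈ Finset.univ.erase e, if ω f = true then p else 1 - p := by
    refine Finset.prod_congr rfl fun f hf => ?_
    rw [Function.update_of_ne (Finset.ne_of_mem_erase hf)]
  unfold weight
  rw [hR, hR (Function.update ω e true), hsame]
  set R := ∏ f ∈ Finset.univ.erase e, if ω f = true then p else 1 - p with hRdef
  have hR0 : 0 ≤ R := Finset.prod_nonneg fun f _ => by
    split_ifs
    · exact hp0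
    · linarith
  set k' := clusterCount T B (Function.update ω e true)
  have hk : q ^ clusterCount T B ω ≤ q ^ (k' + 1) :=
    pow_le_pow_right₀ hq (clusterCount_le_update T B ω e)
  simp only [he, Function.update_self, if_true, Bool.false_eq_true, if_false]
  have hq0 : 0 ≤ q ^ k' := pow_nonneg (by linarith) _
  calc (1 - p) * R * q ^ clusterCount T B ω ≤ (1 - p) * R * q ^ (k' + 1) :=
        mul_le_mul_of_nonneg_left hk (mul_nonneg (by linarith) hR0)
    _ = ((1 - p) * q) * (R * q ^ k') := by ring
    _ ≤ (ε * p) * (R * q ^ k') := mul_le_mul_of_nonneg_right hε (mul_nonneg hR0 hq0)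
    _ = ε * (p * R * q ^ k') := by ring

theorem weight_le_openOn [Fintype V] (T B : Set V) {p q ε : ℝ} (hp0 : 0 ≤ p) (hp1 : p ≤ 1)
    (hq : 1 ≤ q) (hε0 : 0 ≤ ε) (hε : (1 - p) * q ≤ ε * p) (ω : Config G)
    (Γ : Finset G.edgeSet) (hΓ : ∀ e ∈ Γ, ω e = false) :
    weight T B p q ω ≤ ε ^ Γ.card * weight T B p q (openOn Γ ω) := by
  classical
  induction Γ using Finset.induction_on with
  | empty =>
    have : openOn ∅ ω = ω := by funext f; simp [openOn]
    simp [this]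
  | insert e Γ he ih =>
    have h1 := ih fun f hf => hΓ f (Finset.mem_insert_of_mem hf)
    have h2 : openOn (insert e Γ) ω = Function.update (openOn Γ ω) e true := by
      funext f
      by_cases hf : f = e
      · subst hf; simp [openOn]
      · rw [Function.update_of_ne hf]; simp [openOn, hf]
    have h3 := weight_le_update T B hp0 hp1 hq hε (openOn Γ ω) e
      (by simp [openOn, he, hΓ e (Finset.mem_insert_self _ _)])
    rw [Finset.card_insert_of_notMem he, h2, pow_succ, mul_assoc]
    exact h1.trans (mul_le_mul_of_nonneg_left h3 (pow_nonneg hε0 _))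

/-- The edges of Γ are known to have been closed, so opening them loses no information; the only
multiplicity in the Peierls map is the choice of Γ. -/
theorem openOn_injOn (Γ : Finset G.edgeSet) :
    Set.InjOn (openOn Γ) {ω : Config G | ∀ e ∈ Γ, ω e = false} := by
  intro ω hω ω' hω' h
  funext e
  by_cases he : e ∈ Γ
  · rw [hω e he, hω' e he]
  · simpa [openOn, he] using congrFun h e

theorem sum_biUnion_le_sum_sum {ι α : Type*} [DecidableEq α] {f : α → ℝ} (hf : ∀ a, 0 ≤ f a)
    (s : Finset ι) (t : ι → Finset α) : ∑ a ∈ s.biUnion t, f a ≤ ∑ i ∈ s, ∑ a ∈ t i, f a := by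
  classical
  induction s using Finset.induction_on with
  | empty => simp
  | insert i s hi ih =>
    rw [Finset.biUnion_insert, Finset.sum_insert hi]
    have h := Finset.sum_union_inter (s₁ := t i) (s₂ := s.biUnion t) (f := f)
    have h0 : 0 ≤ ∑ a ∈ t i ∩ s.biUnion t, f a := Finset.sum_nonneg fun a _ => hf a
    linarith

open Classical in
/-- Peierls estimate: a set of configurations in each of which one can open one of the edge sets
of the family `𝓕`, made of at least `m` closed edges, while staying in `D`, has weight at most
`#𝓕 * ε ^ m` times that of `D`. -/
theorem sum_weight_le [Fintype V] (T B : Set V) {p q ε : ℝ} (hp0 : 0 ≤ p) (hp1 : p ≤ 1)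
    (hq : 1 ≤ q) (hε0 : 0 ≤ ε) (hε1 : ε ≤ 1) (hε : (1 - p) * q ≤ ε * p)
    (S D : Set (Config G)) (𝓕 : Finset (Finset G.edgeSet)) (m : ℕ)
    (h : ∀ ω ∈ S, ∃ Γ ∈ 𝓕, m ≤ Γ.card ∧ (∀ e ∈ Γ, ω e = false) ∧ openOn Γ ω ∈ D) :
    ∑ ω ∈ Finset.univ.filter (· ∈ S), weight T B p q ω ≤
      𝓕.card * ε ^ m * ∑ ω ∈ Finset.univ.filter (· ∈ D), weight T B p q ω := by
  have hw := weight_nonneg (G := G) T B hp0 hp1 (by linarith : 0 ≤ q)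
  set W := ∑ ω ∈ Finset.univ.filter (· ∈ D), weight T B p q ω
  let A : Finset G.edgeSet → Finset (Config G) := fun Γ =>
    Finset.univ.filter fun ω => m ≤ Γ.card ∧ (∀ e ∈ Γ, ω e = false) ∧ openOn Γ ω ∈ D
  have hA : ∀ Γ ∈ 𝓕, ∑ ω ∈ A Γ, weight T B p q ω ≤ ε ^ m * W := by
    intro Γ _
    calc ∑ ω ∈ A Γ, weight T B p q ω
        ≤ ∑ ω ∈ A Γ, ε ^ m * weight T B p q (openOn Γ ω) := by
          refine Finset.sum_le_sum fun ω hω => ?_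
          obtain ⟨h1, h2, _⟩ := (Finset.mem_filter.1 hω).2
          exact (weight_le_openOn T B hp0 hp1 hq hε0 hε ω Γ h2).trans
            (mul_le_mul_of_nonneg_right (pow_le_pow_of_le_one hε0 hε1 h1) (hw _))
      _ = ε ^ m * ∑ ω ∈ (A Γ).image (openOn Γ), weight T B p q ω := by
          rw [← Finset.mul_sum, Finset.sum_image]
          intro ω hω ω' hω'
          exact openOn_injOn Γ (Finset.mem_filter.1 hω).2.2.1 (Finset.mem_filter.1 hω').2.2.1
      _ ≤ ε ^ m * W := by
          refine mul_le_mul_of_nonneg_left ?_ (pow_nonneg hε0 _)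
          refine Finset.sum_le_sum_of_subset_of_nonneg ?_ fun _ _ _ => hw _
          intro ω hω
          obtain ⟨ω', hω', rfl⟩ := Finset.mem_image.1 hω
          exact Finset.mem_filter.2 ⟨Finset.mem_univ _, (Finset.mem_filter.1 hω').2.2.2⟩
  calc ∑ ω ∈ Finset.univ.filter (· ∈ S), weight T B p q ω
      ≤ ∑ ω ∈ 𝓕.biUnion A, weight T B p q ω := by
        refine Finset.sum_le_sum_of_subset_of_nonneg ?_ fun _ _ _ => hw _
        intro ω hω
        obtain ⟨Γ, hΓ, h1⟩ := h ω (Finset.mem_filter.1 hω).2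
        exact Finset.mem_biUnion.2 ⟨Γ, hΓ, Finset.mem_filter.2 ⟨Finset.mem_univ _, h1⟩⟩
    _ ≤ ∑ Γ ∈ 𝓕, ∑ ω ∈ A Γ, weight T B p q ω := sum_biUnion_le_sum_sum hw 𝓕 A
    _ ≤ ∑ Γ ∈ 𝓕, ε ^ m * W := Finset.sum_le_sum hA
    _ = 𝓕.card * ε ^ m * W := by rw [Finset.sum_const, nsmul_eq_mul, mul_assoc]

open Classical in
theorem fkMeasure_apply [Fintype V] (T B : Set V) {p q : ℝ} (hp0 : 0 ≤ p) (hp1 : p ≤ 1)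
    (hq : 0 ≤ q) (S : Set (Config G)) :
    fkMeasure G T B p q S = ENNReal.ofReal
      ((∑ ω ∈ Finset.univ.filter (· ∈ S), weight T B p q ω) / partition G T B p q) := by
  have hw := weight_nonneg (G := G) T B hp0 hp1 hq
  have hZ : 0 ≤ partition G T B p q := Finset.sum_nonneg fun ω _ => hw ω
  have hS : MeasurableSet S := S.toFinite.measurableSet
  rw [fkMeasure, MeasureTheory.Measure.finsetSum_apply, Finset.sum_div,
    ENNReal.ofReal_sum_of_nonneg fun ω _ => div_nonneg (hw ω) hZ, Finset.sum_filter]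
  refine Finset.sum_congr rfl fun ω _ => ?_
  rw [MeasureTheory.Measure.smul_apply, MeasureTheory.Measure.dirac_apply' _ hS]
  by_cases h : ω ∈ S <;> simp [h]

open Classical in
-- The partition function cancels in the conditional probability, which leaves a comparison of
-- unnormalised weights.
theorem cond_fkMeasure_real_le [Fintype V] (T B : Set V) {p q b : ℝ} (hp0 : 0 ≤ p) (hp1 : p ≤ 1)
    (hq : 0 ≤ q) (hb : 0 ≤ b) (D S : Set (Config G))
    (h : ∑ ω ∈ Finset.univ.filter (· ∈ D ∩ S), weight T B p q ω ≤
      b * ∑ ω ∈ Finset.univ.filter (· ∈ D), weight T B p q ω) :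
    (ProbabilityTheory.cond (fkMeasure G T B p q) D).real S ≤ b := by
  have hw := weight_nonneg (G := G) T B hp0 hp1 hq
  have hZ : 0 ≤ partition G T B p q := Finset.sum_nonneg fun ω _ => hw ω
  have hD : MeasurableSet D := D.toFinite.measurableSet
  refine ENNReal.toReal_le_of_le_ofReal hb ?_
  rw [ProbabilityTheory.cond_apply hD]
  have h1 : fkMeasure G T B p q (D ∩ S) ≤ ENNReal.ofReal b * fkMeasure G T B p q D := by
    rw [fkMeasure_apply T B hp0 hp1 hq, fkMeasure_apply T B hp0 hp1 hq, ← ENNReal.ofReal_mul hb,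
      ← mul_div_assoc]
    refine ENNReal.ofReal_le_ofReal (div_le_div_of_nonneg_right ?_ hZ)
    refine le_of_eq_of_le (Finset.sum_congr ?_ fun _ _ => rfl) h
    ext; simp
  calc (fkMeasure G T B p q D)⁻¹ * fkMeasure G T B p q (D ∩ S)
      ≤ (fkMeasure G T B p q D)⁻¹ * (ENNReal.ofReal b * fkMeasure G T B p q D) := by gcongr
    _ = ENNReal.ofReal b * ((fkMeasure G T B p q D)⁻¹ * fkMeasure G T B p q D) := by ring
    -- An inequality and not an equality, so that a null D is covered: there `∞ * 0 = 0`.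
    _ ≤ ENNReal.ofReal b * 1 := by gcongr; exact ENNReal.inv_mul_le_one _
    _ = ENNReal.ofReal b := mul_one _

/-! ### Clusters of T and B, and pivotal edges -/

/-- The vertices joined to `T` by an open path. -/
def cluster (T : Set V) (ω : Config G) : Set V := {v | ∃ a ∈ T, (openGraph ω).Reachable a v}

theorem connected_comm {T B : Set V} {ω : Config G} : Connected T B ω ↔ Connected B T ω :=
  ⟨fun ⟨a, ha, b, hb, h⟩ => ⟨b, hb, a, ha, h.symm⟩, fun ⟨a, ha, b, hb, h⟩ => ⟨b, hb, a, ha, h.symm⟩⟩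

/-- Opening edges that do not touch the cluster of `T` creates no connection. -/
theorem not_connected_openOn {T B : Set V} {ω : Config G} (h : ¬ Connected T B ω)
    {Γ : Finset G.edgeSet} (hΓ : ∀ e ∈ Γ, ∀ v ∈ e.1, v ∉ cluster T ω) :
    ¬ Connected T B (openOn Γ ω) := by
  rintro ⟨a, ha, b, hb, hab⟩
  -- A path from T in the new configuration never leaves the old cluster of T: to use an edge of Γ
  -- it would first have to reach an end of it.
  suffices b ∈ cluster T ω from h (by obtain ⟨a', h1, h2⟩ := this; exact ⟨a', h1, b, hb, h2⟩)
  clear hb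
  rw [SimpleGraph.reachable_iff_reflTransGen] at hab
  induction hab with
  | refl => exact ⟨a, ha, SimpleGraph.Reachable.refl _⟩
  | tail _ hstep ih =>
    rename_i y z _
    obtain ⟨hyz, ht⟩ := openGraph_adj.1 hstep
    by_cases hmem : (⟨s(y, z), hyz⟩ : G.edgeSet) ∈ Γ
    · exact absurd ih (hΓ _ hmem y (Sym2.mem_mk_left _ _))
    · obtain ⟨a', h1, h2⟩ := ih
      refine ⟨a', h1, h2.trans (SimpleGraph.Adj.reachable (openGraph_adj.2 ⟨hyz, ?_⟩))⟩
      simpa [openOn, hmem] using ht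

open Classical in
/-- A closed edge touching both clusters is pivotal. -/
theorem mem_pivotalEdges {T B : Set V} {ω : Config G} (h : ¬ Connected T B ω) {e : G.edgeSet}
    {u v : V} (hu : u ∈ e.1) (hv : v ∈ e.1) (hT : u ∈ cluster T ω) (hB : v ∈ cluster B ω) :
    e ∈ pivotalEdges T B ω := by
  obtain ⟨a, ha, hau⟩ := hT
  obtain ⟨b, hb, hbv⟩ := hB
  have huv : u ≠ v := by
    rintro rfl
    exact h ⟨a, ha, b, hb, hau.trans hbv.symm⟩
  have he : e.1 = s(u, v) := (Sym2.mem_and_mem_iff huv).1 ⟨hu, hv⟩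
  have hle : openGraph ω ≤ openGraph (Function.update ω e true) :=
    openGraph_mono (update_true_of_true _)
  have hadj : (openGraph (Function.update ω e true)).Adj u v := by
    have h1 : G.Adj u v := by have := e.2; rwa [he] at this
    refine openGraph_adj.2 ⟨h1, ?_⟩
    have : (⟨s(u, v), h1⟩ : G.edgeSet) = e := Subtype.ext he.symm
    rw [this, Function.update_self]
  exact ⟨a, ha, b, hb, ((hau.mono hle).trans hadj.reachable).trans (hbv.mono hle).symm⟩

open Classical in
/-- Of `2 m` closed non-pivotal edges, one can open `m` without connecting `T` and `B`. -/
theorem exists_subset_openOn_not_connected {T B : Set V} {ω : Config G} (h : ¬ Connected T B ω)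
    {m : ℕ} {Γ : Finset G.edgeSet} (hcard : 2 * m ≤ Γ.card)
    (hpiv : ∀ e ∈ Γ, e ∉ pivotalEdges T B ω) :
    ∃ Γ' ⊆ Γ, m ≤ Γ'.card ∧ ¬ Connected T B (openOn Γ' ω) := by
  -- Edges satisfying P miss the cluster of T; the others touch it and, not being pivotal, miss the
  -- cluster of B. One class has at least m edges.
  set P : G.edgeSet → Prop := fun e => ∀ v ∈ e.1, v ∉ cluster T ω
  have hsum := Finset.card_filter_add_card_filter_not (s := Γ) P
  by_cases hm : m ≤ (Γ.filter P).card
  · exact ⟨Γ.filter P, Finset.filter_subset _ _, hm,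
      not_connected_openOn h fun e he => (Finset.mem_filter.1 he).2⟩
  · refine ⟨Γ.filter fun e => ¬ P e, Finset.filter_subset _ _, by omega, ?_⟩
    rw [connected_comm] at h ⊢
    refine not_connected_openOn h fun e he v hv hvB => ?_
    obtain ⟨heΓ, hP⟩ := Finset.mem_filter.1 he
    simp only [P, not_forall, not_not] at hP
    obtain ⟨u, hu, huT⟩ := hP
    exact hpiv e heΓ (mem_pivotalEdges (mt connected_comm.1 h) hu hv huT hvB)

end FK

/-! ### The cubic lattice and its mod 2 cohomology -/

/-- Adjacent points of the cubic lattice differ by a unit vector. -/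
theorem cubicLattice_adj_iff {d : ℕ} {x y : Fin d → ℤ} :
    (cubicLattice d).Adj x y ↔ ∃ j, y = x + Pi.single j 1 ∨ x = y + Pi.single j 1 := by
  have hdist : (cubicLattice d).Adj x y ↔ ∑ i, (x i - y i) ^ 2 = 1 := by
    change dist (latticePoint x) (latticePoint y) = 1 ↔ _
    rw [EuclideanSpace.dist_eq, Real.sqrt_eq_one]
    simp only [latticePoint, Real.dist_eq, sq_abs]
    exact_mod_cast Iff.rfl
  rw [hdist]
  constructor
  · intro h
    obtain ⟨j, hj⟩ : ∃ j, x j ≠ y j := by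
      by_contra! hne
      simp [hne] at h
    have hsplit := Finset.add_sum_erase Finset.univ (fun i => (x i - y i) ^ 2) (Finset.mem_univ j)
    have hpos : 0 < (x j - y j) ^ 2 := by
      have : x j - y j ≠ 0 := sub_ne_zero.2 hj
      positivity
    have hnn : 0 ≤ ∑ i ∈ Finset.univ.erase j, (x i - y i) ^ 2 :=
      Finset.sum_nonneg fun i _ => sq_nonneg _
    have hz : ∑ i ∈ Finset.univ.erase j, (x i - y i) ^ 2 = 0 := by
      omega
    have hone : (x j - y j) ^ 2 = 1 := by
      omega
    have hrest : ∀ i, i ≠ j → x i = y i := by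
      intro i hi
      have := (Finset.sum_eq_zero_iff_of_nonneg fun i _ => sq_nonneg (x i - y i)).1 hz i
        (Finset.mem_erase.2 ⟨hi, Finset.mem_univ _⟩)
      exact sub_eq_zero.1 (pow_eq_zero_iff two_ne_zero |>.1 this)
    have hpm : x j - y j = 1 ∨ x j - y j = -1 :=
      sq_eq_sq_iff_eq_or_eq_neg.1 (hone.trans (one_pow 2).symm)
    refine ⟨j, hpm.symm.imp ?_ ?_⟩
    · intro h1
      funext i
      by_cases hi : i = j
      · subst hi; simp; omega
      · simp [hi, hrest i hi]
    · intro h1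
      funext i
      by_cases hi : i = j
      · subst hi; simp; omega
      · simp [hi, hrest i hi]
  · rintro ⟨j, rfl | rfl⟩
    · simp [Pi.single_apply]
    · simp [Pi.single_apply]

theorem cubicLattice_adj_add_single {d : ℕ} (x : Fin d → ℤ) (j : Fin d) :
    (cubicLattice d).Adj x (x + Pi.single j 1) := cubicLattice_adj_iff.2 ⟨j, Or.inl rfl⟩

theorem abs_single_one_le {d : ℕ} (j i : Fin d) : |(Pi.single j 1 : Fin d → ℤ) i| ≤ 1 := by
  by_cases h : i = j
  · subst h; simp
  · simp [h]

theorem cubicLattice_adj_abs_le {d : ℕ} {x y : Fin d → ℤ} (h : (cubicLattice d).Adj x y)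
    (i : Fin d) : |y i - x i| ≤ 1 := by
  obtain ⟨j, rfl | rfl⟩ := cubicLattice_adj_iff.1 h
  · simpa using abs_single_one_le j i
  · simpa [abs_neg] using abs_single_one_le j i

/-- The crude factor d in place of √d is absorbed into κ. -/
theorem dist_latticePoint_le {d : ℕ} {x y : Fin d → ℤ} {m : ℕ} (h : ∀ i, |x i - y i| ≤ m) :
    dist (latticePoint x) (latticePoint y) ≤ d * m := by
  rw [EuclideanSpace.dist_eq]
  refine Real.sqrt_le_iff.2 ⟨by positivity, ?_⟩
  have h1 : ∀ i, dist (latticePoint x i) (latticePoint y i) ^ 2 ≤ (m : ℝ) ^ 2 := by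
    intro i
    refine pow_le_pow_left₀ dist_nonneg ?_ 2
    simp only [latticePoint, Real.dist_eq]
    exact_mod_cast h i
  have h2 : (d : ℝ) ≤ (d : ℝ) ^ 2 := by exact_mod_cast Nat.le_self_pow two_ne_zero d
  calc ∑ i, dist (latticePoint x i) (latticePoint y i) ^ 2 ≤ ∑ _i : Fin d, (m : ℝ) ^ 2 :=
        Finset.sum_le_sum fun i _ => h1 i
    _ = d * (m : ℝ) ^ 2 := by simp
    _ ≤ (d : ℝ) ^ 2 * (m : ℝ) ^ 2 := by gcongr
    _ = (d * m : ℝ) ^ 2 := by ring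

/-- A closed finitely supported `1`-cochain of the cubic lattice, with values in `ℤ/2`, is the
coboundary of a function that vanishes away from the support. -/
theorem exists_coboundary {d : ℕ} (hd : 2 ≤ d) (g : (Fin d → ℤ) → Fin d → ZMod 2)
    (c : Fin d → ℤ) (n : ℕ) (hsupp : ∀ x j, g x j ≠ 0 → ∀ i, |x i - c i| ≤ n)
    (hclosed : ∀ x i j, g x i + g (x + Pi.single i 1) j = g x j + g (x + Pi.single j 1) i) :
    ∃ f : (Fin d → ℤ) → ZMod 2, (∀ x j, f x + f (x + Pi.single j 1) = g x j) ∧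
      ∀ x, (∃ i, (n : ℤ) + 1 < |x i - c i|) → f x = 0 := by
  let o : Fin d := ⟨0, by omega⟩
  let o' : Fin d := ⟨1, by omega⟩
  have hoo' : o' ≠ o := by simp [o, o', Fin.ext_iff]
  have hg0 : ∀ x j i, (n : ℤ) < |x i - c i| → g x j = 0 := by
    intro x j i h
    by_contra h0
    exact absurd (hsupp x j h0 i) (not_le.2 h)
  -- Integrate g along the ray from x in direction `o`, stopping where the support has ended;
  -- `toNat` makes the sum empty beyond it.
  let f : (Fin d → ℤ) → ZMod 2 := fun x =>
    ∑ k ∈ Finset.range (c o + n + 1 - x o).toNat, g (x + Pi.single o (k : ℤ)) o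
  have hf : ∀ x j, f x + f (x + Pi.single j 1) = g x j := by
    intro x j
    by_cases hj : j = o
    · subst hj
      by_cases hx : x o ≤ c o + n
      · have hN : (c o + n + 1 - x o).toNat =
            (c o + n + 1 - (x + Pi.single o 1 : Fin d → ℤ) o).toNat + 1 := by
          simp; omega
        have hsh : ∀ k : ℕ, x + Pi.single o ((k + 1 : ℕ) : ℤ) =
            x + Pi.single o 1 + Pi.single o (k : ℤ) := by
          intro k
          rw [add_assoc, ← Pi.single_add]; push_cast; rw [add_comm (1 : ℤ)]
        simp only [f]
        rw [hN, Finset.sum_range_succ']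
        simp only [hsh]
        rw [add_right_comm, CharTwo.add_self_eq_zero]
        simp
      · have h1 : (c o + n + 1 - x o).toNat = 0 := by omega
        have h2 : (c o + n + 1 - (x + Pi.single o 1 : Fin d → ℤ) o).toNat = 0 := by simp; omega
        simp only [f]
        rw [h1, h2, hg0 x o o (by rw [lt_abs]; left; omega)]
        simp
    · have hN : (x + Pi.single j 1 : Fin d → ℤ) o = x o := by simp [Ne.symm hj]
      simp only [f]
      rw [hN, ← Finset.sum_add_distrib]
      set N := (c o + n + 1 - x o).toNat with hNdef
      -- Closedness on the squares between two parallel rays turns the difference of the ray sums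
      -- into a telescoping sum of the rungs `u`, the last of which is beyond the support.
      let u : ℕ → ZMod 2 := fun k => g (x + Pi.single o (k : ℤ)) j
      have hstep : ∀ k ∈ Finset.range N, g (x + Pi.single o (k : ℤ)) o +
          g (x + Pi.single j 1 + Pi.single o (k : ℤ)) o = u (k + 1) - u k := by
        intro k _
        have h1 := hclosed (x + Pi.single o (k : ℤ)) o j
        have h2 : x + Pi.single o (k : ℤ) + Pi.single o 1 =
            x + Pi.single o ((k + 1 : ℕ) : ℤ) := by
          rw [add_assoc, ← Pi.single_add]; push_cast; rfl
        rw [h2, add_right_comm x] at h1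
        simp only [u]
        rw [CharTwo.sub_eq_add]
        generalize g (x + Pi.single o (k : ℤ)) o = a1 at *
        generalize g (x + Pi.single j 1 + Pi.single o (k : ℤ)) o = a2 at *
        generalize g (x + Pi.single o ((k + 1 : ℕ) : ℤ)) j = a3 at *
        generalize g (x + Pi.single o (k : ℤ)) j = a4 at *
        revert a1 a2 a3 a4; decide
      rw [Finset.sum_congr rfl hstep, Finset.sum_range_sub]
      have hN0 : u N = 0 := by
        refine hg0 _ _ o ?_
        simp only [Pi.add_apply, Pi.single_eq_same]
        rw [lt_abs]; left; omega
      rw [hN0]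
      simp [u, CharTwo.neg_eq]
  have hfar : ∀ x i, i ≠ o → (n : ℤ) < |x i - c i| → f x = 0 := by
    intro x i hi h
    refine Finset.sum_eq_zero fun k _ => hg0 _ _ i ?_
    simpa [hi] using h
  refine ⟨f, hf, ?_⟩
  rintro x ⟨i, hi⟩
  by_cases hio : i = o
  · subst hio
    rcases lt_abs.1 hi with h | h
    · have h1 : (c o + n + 1 - x o).toNat = 0 := by omega
      simp only [f]
      rw [h1]; simp
    -- Behind the support the ray may cross it. But g vanishes on this layer, so f is constant in
    -- the second direction `o'`, along which one reaches rays missing the support. This is where d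
    -- ≥ 2 matters.
    · have hconst : ∀ k : ℕ, f (x + Pi.single o' (k : ℤ)) = f x := by
        intro k
        induction k with
        | zero => simp
        | succ k ih =>
          have h1 := hf (x + Pi.single o' (k : ℤ)) o'
          rw [hg0 _ _ o (by simp [hoo'.symm]; omega), add_assoc, ← Pi.single_add,
            CharTwo.add_eq_zero] at h1
          push_cast
          rw [← h1, ih]
      rw [← hconst (c o' + n + 1 - x o').toNat]
      refine hfar _ o' hoo' ?_
      simp only [Pi.add_apply, Pi.single_eq_same]
      rw [lt_abs]; left; omega
  · exact hfar x i hio (by omega)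

/-! ### The two sides of a cut -/

namespace FK

variable {V : Type*} {G : SimpleGraph V}

/-- The vertices joined to `T` by a path that avoids the edges of `C`. -/
def side (T : Set V) (C : Set G.edgeSet) : Set V :=
  {v | ∃ a ∈ T, (G.deleteEdges (Subtype.val '' C)).Reachable a v}

theorem deleteEdges_adj_iff {C : Set G.edgeSet} {x y : V} :
    (G.deleteEdges (Subtype.val '' C)).Adj x y ↔
      ∃ h : G.Adj x y, (⟨s(x, y), h⟩ : G.edgeSet) ∉ C := by
  rw [SimpleGraph.deleteEdges_adj]
  constructor
  · rintro ⟨h, h1⟩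
    exact ⟨h, fun h2 => h1 ⟨_, h2, rfl⟩⟩
  · rintro ⟨h, h1⟩
    refine ⟨h, ?_⟩
    rintro ⟨f, hf, hfe⟩
    exact h1 (by rwa [show (⟨s(x, y), h⟩ : G.edgeSet) = f from Subtype.ext hfe.symm])

theorem disjoint_side {T B : Set V} {C : Set G.edgeSet} (hC : Separates G T B C) :
    Disjoint (side T C) (side B C) := by
  rw [Set.disjoint_left]
  rintro v ⟨a, ha, hav⟩ ⟨b, hb, hbv⟩
  exact hC a ha b hb (hav.trans hbv.symm)

/-- Each edge of a cut joins the side of `T` to the side of `B`. -/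
theorem IsCut.exists_endpoints {T B : Set V} {C : Set G.edgeSet} (hC : IsCut G T B C)
    {e : G.edgeSet} (he : e ∈ C) :
    ∃ u v, e.1 = s(u, v) ∧ u ∈ side T C ∧ v ∈ side B C := by
  -- By minimality, restoring e alone connects T to B. Such a connection must use e, and the parts
  -- before and after e can be taken to avoid C.
  have hnot : ¬ Separates G T B (C \ {e}) := by
    intro h
    exact (hC.2 h Set.sdiff_subset he).2 rfl
  simp only [Separates, not_forall, not_not] at hnot
  obtain ⟨a, ha, b, hb, hab⟩ := hnot
  obtain ⟨⟨x, y⟩, hxy⟩ := e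
  have hadj : ∀ z w, (G.deleteEdges (Subtype.val '' (C \ {⟨s(x, y), hxy⟩}))).Adj z w →
      (G.deleteEdges (Subtype.val '' C)).Adj z w ∨ (z = x ∧ w = y) ∨ (z = y ∧ w = x) := by
    intro z w hzw
    obtain ⟨h1, h2⟩ := deleteEdges_adj_iff.1 hzw
    by_cases h3 : (⟨s(z, w), h1⟩ : G.edgeSet) ∈ C
    · right
      have h4 : (⟨s(z, w), h1⟩ : G.edgeSet) = ⟨s(x, y), hxy⟩ := by
        by_contra h5
        exact h2 ⟨h3, h5⟩
      exact Sym2.eq_iff.1 (congrArg Subtype.val h4)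
    · exact Or.inl (deleteEdges_adj_iff.2 ⟨h1, h3⟩)
  rcases reachable_or_of_adj_or hadj hab with h | h | h
  · exact absurd h (hC.1 a ha b hb)
  · exact ⟨x, y, rfl, ⟨a, ha, h.1⟩, ⟨b, hb, h.2.symm⟩⟩
  · exact ⟨y, x, Sym2.eq_swap, ⟨a, ha, h.1⟩, ⟨b, hb, h.2.symm⟩⟩

end FK

/-! ### Star-components of a cut are long -/

namespace Box

variable {d : ℕ} (L : Box d)

/-- The edge of the box joining `x` to `x + e_j`. -/
def mkEdge (x : Fin d → ℤ) (j : Fin d) (hx : latticePoint x ∈ L.cube)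
    (hy : latticePoint (x + Pi.single j 1) ∈ L.cube) : L.graph.edgeSet :=
  ⟨s(⟨x, hx⟩, ⟨x + Pi.single j 1, hy⟩), cubicLattice_adj_add_single x j⟩

theorem exists_eq_mkEdge (e : L.graph.edgeSet) :
    ∃ b : (Fin d → ℤ) × Fin d, ∃ hx hy, e = L.mkEdge b.1 b.2 hx hy := by
  obtain ⟨⟨⟨x, hx⟩, ⟨y, hy⟩⟩, he⟩ := e
  obtain ⟨j, h | h⟩ := cubicLattice_adj_iff.1 (show (cubicLattice d).Adj x y from he)
  · subst h
    exact ⟨(x, j), hx, hy, rfl⟩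
  · subst h
    exact ⟨(y, j), hy, hx, Subtype.ext Sym2.eq_swap⟩

/-- The point `x` and the direction `j` such that the edge joins `x` to `x + e_j`. -/
noncomputable def base (e : L.graph.edgeSet) : (Fin d → ℤ) × Fin d :=
  (L.exists_eq_mkEdge e).choose

theorem exists_eq_mkEdge_base (e : L.graph.edgeSet) :
    ∃ hx hy, e = L.mkEdge (L.base e).1 (L.base e).2 hx hy :=
  (L.exists_eq_mkEdge e).choose_spec

theorem base_injective : Function.Injective L.base := by
  intro e f h
  obtain ⟨h1, h2, h3⟩ := L.exists_eq_mkEdge_base e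
  obtain ⟨h4, h5, h6⟩ := L.exists_eq_mkEdge_base f
  rw [h3, h6]
  congr 1 <;> rw [h]

/-- The reverse orientation would force e_j + e_k = 0, so the base chosen for an edge is the only
possible one. -/
theorem base_mkEdge (x : Fin d → ℤ) (j : Fin d) (hx hy) : L.base (L.mkEdge x j hx hy) = (x, j) := by
  obtain ⟨h1, h2, h3⟩ := L.exists_eq_mkEdge_base (L.mkEdge x j hx hy)
  generalize L.base (L.mkEdge x j hx hy) = b at h1 h2 h3
  obtain ⟨y, k⟩ := b
  have h4 := congrArg Subtype.val h3
  simp only [mkEdge, Sym2.eq_iff, Subtype.mk.injEq] at h4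
  rcases h4 with ⟨rfl, h5⟩ | ⟨h5, h6⟩
  · have h6 := congrFun (add_left_cancel h5) j
    by_cases hjk : k = j
    · rw [hjk]
    · simp [Ne.symm hjk] at h6
  · exfalso
    have h7 := congrFun h5 j
    have h8 := congrFun h6 j
    by_cases hjk : j = k
    · subst hjk; simp at h7 h8; omega
    · simp [hjk] at h7 h8; omega

/-- Two edges of `C` are joined when their base points are at sup-distance at most one. -/
def star (C : Set L.graph.edgeSet) : SimpleGraph L.graph.edgeSet where
  Adj e f := e ≠ f ∧ e ∈ C ∧ f ∈ C ∧ ∀ i, |(L.base e).1 i - (L.base f).1 i| ≤ 1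
  symm := ⟨fun _ _ h => ⟨h.1.symm, h.2.2.1, h.2.1, fun i => by rw [abs_sub_comm]; exact h.2.2.2 i⟩⟩
  loopless := ⟨fun _ h => h.1 rfl⟩

theorem abs_base_sub_le_length {C : Set L.graph.edgeSet} {e f : L.graph.edgeSet}
    (p : (L.star C).Walk e f) (i : Fin d) : |(L.base f).1 i - (L.base e).1 i| ≤ p.length := by
  induction p with
  | nil => simp
  | cons h p ih =>
    have h1 := h.2.2.2 i
    rw [SimpleGraph.Walk.length_cons]
    push_cast
    rw [abs_le] at *
    constructor <;> omega

theorem star_mem {C : Set L.graph.edgeSet} {e f : L.graph.edgeSet} (he : e ∈ C)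
    (h : (L.star C).Reachable e f) : f ∈ C := by
  rw [SimpleGraph.reachable_iff_reflTransGen] at h
  induction h with
  | refl => exact he
  | tail _ h _ => exact h.2.2.1

open Classical in
/-- The indicator function of a set of vertices of the box. -/
noncomputable def indicator (A : Set L.Vertex) (x : Fin d → ℤ) : ZMod 2 :=
  if ∃ h : latticePoint x ∈ L.cube, (⟨x, h⟩ : L.Vertex) ∈ A then 1 else 0

theorem indicator_of_mem {A : Set L.Vertex} {x : L.Vertex} (h : x ∈ A) :
    L.indicator A x.1 = 1 := if_pos ⟨x.2, h⟩

theorem indicator_of_notMem {A : Set L.Vertex} {x : L.Vertex} (h : x ∉ A) :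
    L.indicator A x.1 = 0 := if_neg fun ⟨_, h1⟩ => h h1

open Classical in
/-- The cut is the coboundary of the side of `T`. -/
theorem indicator_side_add {T B : Set L.Vertex} {C : Set L.graph.edgeSet}
    (hC : FK.IsCut L.graph T B C) (x : Fin d → ℤ) (j : Fin d) (hx hy) :
    L.indicator (FK.side T C) x + L.indicator (FK.side T C) (x + Pi.single j 1) =
      if L.mkEdge x j hx hy ∈ C then 1 else 0 := by
  have hdisj := Set.disjoint_left.1 (FK.disjoint_side hC.1)
  by_cases h : L.mkEdge x j hx hy ∈ C
  · rw [if_pos h]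
    obtain ⟨u, v, huv, hu, hv⟩ := hC.exists_endpoints h
    have h1 := L.indicator_of_mem hu
    have h2 := L.indicator_of_notMem fun h' => hdisj h' hv
    rcases Sym2.eq_iff.1 huv with ⟨rfl, rfl⟩ | ⟨rfl, rfl⟩
    · simp only at h1 h2
      rw [h1, h2]; rfl
    · simp only at h1 h2
      rw [h1, h2]; rfl
  · rw [if_neg h]
    have hadj : (L.graph.deleteEdges (Subtype.val '' C)).Adj ⟨x, hx⟩ ⟨x + Pi.single j 1, hy⟩ :=
      FK.deleteEdges_adj_iff.2 ⟨cubicLattice_adj_add_single x j, h⟩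
    by_cases hA : (⟨x, hx⟩ : L.Vertex) ∈ FK.side T C
    · obtain ⟨a, ha, hax⟩ := hA
      have h1 := L.indicator_of_mem (A := FK.side T C) (x := ⟨x, hx⟩) ⟨a, ha, hax⟩
      have h2 := L.indicator_of_mem (A := FK.side T C) (x := ⟨x + Pi.single j 1, hy⟩)
        ⟨a, ha, hax.trans hadj.reachable⟩
      simp only at h1 h2
      rw [h1, h2]; rfl
    · have h1 := L.indicator_of_notMem hA
      have h2 := L.indicator_of_notMem (A := FK.side T C) (x := ⟨x + Pi.single j 1, hy⟩)
        fun ⟨a, ha, hax⟩ => hA ⟨a, ha, hax.trans hadj.reachable.symm⟩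
      simp only at h1 h2
      rw [h1, h2]; rfl

open Classical in
/-- In a cut, the star-component of an edge deep inside the box contains long simple paths. -/
theorem exists_isPath_star (hd : 2 ≤ d) {T B : Set L.Vertex} (hT : T ⊆ L.boundary)
    (hB : B ⊆ L.boundary) {C : Set L.graph.edgeSet} (hC : FK.IsCut L.graph T B C)
    {e : L.graph.edgeSet} (he : e ∈ C) (n : ℕ)
    (hball : ∀ z : Fin d → ℤ, (∀ i, |z i - (L.base e).1 i| ≤ n + 2) → latticePoint z ∈ L.cube) :
    ∃ f, ∃ p : (L.star C).Walk e f, p.IsPath ∧ p.length = n := by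
  by_contra hcon
  -- A simple path of length at least n could be truncated to length n, so all simple paths from e
  -- are shorter and the component is confined.
  have hnear : ∀ f, (L.star C).Reachable e f → ∀ i, |(L.base f).1 i - (L.base e).1 i| ≤ n := by
    intro f hf i
    obtain ⟨p, hp⟩ := hf.exists_isPath
    have hlt : p.length < n := by
      by_contra hge
      exact hcon ⟨_, p.take n, hp.take n, by rw [SimpleGraph.Walk.take_length]; omega⟩
    exact (L.abs_base_sub_le_length p i).trans (by exact_mod_cast hlt.le)
  let P : (Fin d → ℤ) → Fin d → Prop := fun x j =>
    ∃ f, (L.star C).Reachable e f ∧ L.base f = (x, j)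
  let g : (Fin d → ℤ) → Fin d → ZMod 2 := fun x j => if P x j then 1 else 0
  let a := L.indicator (FK.side T C)
  have hnearP : ∀ x j, P x j → ∀ i, |x i - (L.base e).1 i| ≤ n := by
    rintro x j ⟨f, hf, hfb⟩ i
    have := hnear f hf i
    rwa [hfb] at this
  -- Near the component, an edge lies in it as soon as it lies in C. Hence its indicator `g` agrees
  -- there with the coboundary of the side of T, which is closed.
  have hloc : ∀ x j y k, P x j → (∀ i, |x i - y i| ≤ 1) →
      g y k = a y + a (y + Pi.single k 1) := by
    intro x j y k hP hxy
    have hx := hnearP x j hP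
    have hy : latticePoint y ∈ L.cube := hball y fun i => by
      have h1 := hx i
      have h2 := hxy i
      rw [abs_le] at *
      constructor <;> omega
    have hy' : latticePoint (y + Pi.single k 1) ∈ L.cube := hball _ fun i => by
      have h1 := hx i
      have h2 := hxy i
      have h3 := abs_single_one_le k i
      rw [Pi.add_apply]
      rw [abs_le] at *
      constructor <;> omega
    rw [show a y + a (y + Pi.single k 1) = _ from L.indicator_side_add hC y k hy hy']
    have hiff : P y k ↔ L.mkEdge y k hy hy' ∈ C := by
      constructor
      · rintro ⟨f, hf, hfb⟩
        have : f = L.mkEdge y k hy hy' := L.base_injective (hfb.trans (L.base_mkEdge _ _ _ _).symm)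
        exact this ▸ L.star_mem he hf
      · intro hmem
        refine ⟨_, ?_, L.base_mkEdge y k hy hy'⟩
        obtain ⟨f, hf, hfb⟩ := hP
        by_cases hfe : f = L.mkEdge y k hy hy'
        · exact hfe ▸ hf
        · refine hf.trans (SimpleGraph.Adj.reachable ⟨hfe, L.star_mem he hf, hmem, fun i => ?_⟩)
          rw [hfb, L.base_mkEdge]
          exact hxy i
    simp only [g, hiff]
  have hclosed : ∀ x i j,
      g x i + g (x + Pi.single i 1) j = g x j + g (x + Pi.single j 1) i := by
    intro x i j
    by_cases hij : i = j
    · rw [hij]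
    -- Either the square is near a component edge and `hloc` applies to its four edges, or none of
    -- them is in the component, since their base points are within sup-distance one of each other.
    by_cases hex : ∃ y k, P y k ∧ (∀ l, |y l - x l| ≤ 1) ∧
        (∀ l, |y l - (x + Pi.single i 1 : Fin d → ℤ) l| ≤ 1) ∧
        (∀ l, |y l - (x + Pi.single j 1 : Fin d → ℤ) l| ≤ 1)
    · obtain ⟨y, k, hP, h0, h1, h2⟩ := hex
      rw [hloc y k x i hP h0, hloc y k x j hP h0, hloc y k _ j hP h1, hloc y k _ i hP h2,
        add_right_comm x (Pi.single j 1)]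
      generalize a x = a1
      generalize a (x + Pi.single i 1) = a2
      generalize a (x + Pi.single j 1) = a3
      generalize a (x + Pi.single i 1 + Pi.single j 1) = a4
      revert a1 a2 a3 a4; decide
    · have hz : ∀ l, |x l - x l| ≤ 1 := by simp
      have hs : ∀ (k l : Fin d), |x l - (x + Pi.single k 1 : Fin d → ℤ) l| ≤ 1 := fun k l => by
        simpa using abs_single_one_le k l
      have hs' : ∀ (k l : Fin d), |(x + Pi.single k 1 : Fin d → ℤ) l - x l| ≤ 1 := fun k l => by
        simpa using abs_single_one_le k l
      have hss : ∀ (k k' l : Fin d), |(x + Pi.single k 1 : Fin d → ℤ) l -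
          (x + Pi.single k' 1 : Fin d → ℤ) l| ≤ 1 := fun k k' l => by
        simp only [Pi.add_apply, Pi.single_apply]
        split_ifs <;> simp
      have n1 : ∀ k, ¬ P x k := fun k hP => hex ⟨x, k, hP, hz, hs i, hs j⟩
      have n2 : ¬ P (x + Pi.single i 1) j := fun hP => hex ⟨_, j, hP, hs' i, hss i i, hss i j⟩
      have n3 : ¬ P (x + Pi.single j 1) i := fun hP => hex ⟨_, i, hP, hs' j, hss j i, hss j j⟩
      simp only [g, n1, n2, n3, if_false]
  obtain ⟨F, hF, hF0⟩ := exists_coboundary hd g (L.base e).1 n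
    (fun x j h => hnearP x j (by by_contra h'; exact h (if_neg h'))) hclosed
  have hFadj : ∀ x y : L.Vertex, (L.graph.deleteEdges (Subtype.val '' C)).Adj x y →
      F x.1 = F y.1 := by
    have hF1 : ∀ (x : Fin d → ℤ) (j : Fin d) hx hy, L.mkEdge x j hx hy ∉ C →
        F x = F (x + Pi.single j 1) := by
      intro x j hx hy hm
      refine CharTwo.add_eq_zero.1 ((hF x j).trans (if_neg ?_))
      rintro ⟨f, hf, hfb⟩
      have : f = L.mkEdge x j hx hy := L.base_injective (hfb.trans (L.base_mkEdge _ _ _ _).symm)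
      exact hm (this ▸ L.star_mem he hf)
    rintro ⟨x, hx⟩ ⟨y, hy⟩ hxy
    obtain ⟨h1, h2⟩ := FK.deleteEdges_adj_iff.1 hxy
    obtain ⟨j, h | h⟩ := cubicLattice_adj_iff.1 (show (cubicLattice d).Adj x y from h1)
    · subst h
      exact hF1 x j hx hy h2
    · subst h
      have hswap : (⟨s(⟨y + Pi.single j 1, hx⟩, ⟨y, hy⟩), h1⟩ : L.graph.edgeSet) =
          L.mkEdge y j hy hx := Subtype.ext Sym2.eq_swap
      exact (hF1 y j hy hx (hswap ▸ h2)).symm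
  -- The radius n + 2 in `hball` is used here: a neighbour of x is outside the cube, so x is at
  -- sup-distance more than n + 1 from the base of e.
  have hFbdry : ∀ x ∈ L.boundary, F x.1 = 0 := by
    rintro x ⟨y, hy, hxy⟩
    refine hF0 _ ?_
    by_contra hle
    simp only [not_exists, not_lt] at hle
    refine hy (hball y fun i => ?_)
    have h1 := hle i
    have h2 := cubicLattice_adj_abs_le hxy i
    rw [abs_le] at *
    constructor <;> omega
  have hFside : ∀ X : Set L.Vertex, X ⊆ L.boundary → ∀ v ∈ FK.side X C, F v.1 = 0 := by
    rintro X hX v ⟨t, ht, htv⟩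
    rw [← hFbdry t (hX ht)]
    rw [SimpleGraph.reachable_iff_reflTransGen] at htv
    induction htv with
    | refl => rfl
    | tail _ h ih => rw [← hFadj _ _ h, ih]
  obtain ⟨u, v, huv, hu, hv⟩ := hC.exists_endpoints he
  obtain ⟨hx, hy, hxy⟩ := L.exists_eq_mkEdge_base e
  -- The contradiction: F jumps by 1 across e, whose ends lie on the two sides, where F vanishes.
  have hone : F (L.base e).1 + F ((L.base e).1 + Pi.single (L.base e).2 1) = 1 :=
    (hF _ _).trans (if_pos ⟨e, SimpleGraph.Reachable.refl _, rfl⟩)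
  have h1 := hFside T hT u hu
  have h2 := hFside B hB v hv
  rw [congrArg Subtype.val hxy] at huv
  rcases Sym2.eq_iff.1 huv with ⟨rfl, rfl⟩ | ⟨rfl, rfl⟩
  · simp only at h1 h2
    rw [h1, h2] at hone
    simp at hone
  · simp only at h1 h2
    rw [h1, h2] at hone
    simp at hone

end Box

/-! ### Counting chains of edges -/

open Classical in
/-- The lists `[a₁, …, aₙ]` with `a₁ ∈ N a` and `aᵢ₊₁ ∈ N aᵢ`. -/
noncomputable def chains {α : Type*} (N : α → Finset α) : ℕ → α → Finset (List α)
  | 0, _ => {[]}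
  | n + 1, a => (N a).biUnion fun b => (chains N n b).image (b :: ·)

theorem card_chains_le {α : Type*} (N : α → Finset α) (D : ℕ) (hN : ∀ a, (N a).card ≤ D) (n : ℕ)
    (a : α) : (chains N n a).card ≤ D ^ n := by
  classical
  induction n generalizing a with
  | zero => simp [chains]
  | succ n ih =>
    calc (chains N (n + 1) a).card ≤ (N a).card * D ^ n :=
          Finset.card_biUnion_le_card_mul _ _ _ fun b _ => Finset.card_image_le.trans (ih b)
      _ ≤ D ^ (n + 1) := by rw [pow_succ']; exact Nat.mul_le_mul_right _ (hN a)

theorem length_of_mem_chains {α : Type*} {N : α → Finset α} {n : ℕ} {a : α} {l : List α}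
    (h : l ∈ chains N n a) : l.length = n := by
  classical
  induction n generalizing a l with
  | zero => simp [chains] at h; simp [h]
  | succ n ih =>
    simp only [chains, Finset.mem_biUnion, Finset.mem_image] at h
    obtain ⟨b, _, l', hl', rfl⟩ := h
    simp [ih hl']

theorem support_tail_mem_chains {α : Type*} {N : α → Finset α} {H : SimpleGraph α}
    (hN : ∀ a b, H.Adj a b → b ∈ N a) {a b : α} (p : H.Walk a b) :
    p.support.tail ∈ chains N p.length a := by
  classical
  induction p with
  | nil => simp [chains]
  | cons h p ih =>
    rw [SimpleGraph.Walk.support_cons, List.tail_cons, SimpleGraph.Walk.length_cons, chains]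
    refine Finset.mem_biUnion.2 ⟨_, hN _ _ h, Finset.mem_image.2 ⟨_, ih, ?_⟩⟩
    exact SimpleGraph.Walk.cons_tail_support p

namespace Box

variable {d : ℕ} (L : Box d)

open Classical in
/-- The edges whose base points are at sup-distance at most one from that of `e`. -/
noncomputable def nbrs (e : L.graph.edgeSet) : Finset L.graph.edgeSet :=
  Finset.univ.filter fun f => ∀ i, |(L.base e).1 i - (L.base f).1 i| ≤ 1

theorem card_nbrs_le (e : L.graph.edgeSet) : (L.nbrs e).card ≤ 3 ^ d * d := by
  classical
  calc (L.nbrs e).card = ((L.nbrs e).image L.base).card :=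
        (Finset.card_image_of_injective _ L.base_injective).symm
    _ ≤ ((Fintype.piFinset fun i =>
          Finset.Icc ((L.base e).1 i - 1) ((L.base e).1 i + 1)) ×ˢ
            (Finset.univ : Finset (Fin d))).card := by
        refine Finset.card_le_card fun b hb => ?_
        obtain ⟨f, hf, rfl⟩ := Finset.mem_image.1 hb
        refine Finset.mem_product.2 ⟨Fintype.mem_piFinset.2 fun i => ?_, Finset.mem_univ _⟩
        have := abs_le.1 ((Finset.mem_filter.1 hf).2 i)
        rw [Finset.mem_Icc]
        omega
    _ = 3 ^ d * d := by
        rw [Finset.card_product, Fintype.card_piFinset, Finset.card_univ, Fintype.card_fin]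
        have : ∀ z : ℤ, (z + 1 + 1 - (z - 1)).toNat = 3 := fun z => by omega
        simp [Int.card_Icc, this]

open Classical in
theorem card_edgeSet_le : Fintype.card L.graph.edgeSet ≤ L.size * d := by
  have h := Fintype.card_le_of_injective
    (fun e : L.graph.edgeSet =>
      ((⟨(L.base e).1, (L.exists_eq_mkEdge_base e).1⟩, (L.base e).2) : L.Vertex × Fin d))
    (fun e f h => L.base_injective (by
      simp only [Prod.mk.injEq, Subtype.mk.injEq] at h
      exact Prod.ext h.1 h.2))
  simpa [size] using h

open Classical in
/-- The sets of edges visited by a chain of `n` steps, and their subsets. -/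
noncomputable def chainSets (n : ℕ) : Finset (Finset L.graph.edgeSet) :=
  Finset.univ.biUnion fun e => (chains L.nbrs n e).biUnion fun l => l.toFinset.powerset

/-- The factors count the starting edges, the chains from each, and the subsets of a chain; subsets
are needed because which edges may be opened depends on the configuration. -/
theorem card_chainSets_le (n : ℕ) :
    (L.chainSets n).card ≤ L.size * d * ((3 ^ d * d) ^ n * 2 ^ n) := by
  classical
  refine (Finset.card_biUnion_le_card_mul _ _ ((3 ^ d * d) ^ n * 2 ^ n) fun e _ => ?_).trans
    (Nat.mul_le_mul_right _ L.card_edgeSet_le)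
  refine (Finset.card_biUnion_le_card_mul _ _ (2 ^ n) fun l hl => ?_).trans
    (Nat.mul_le_mul_right _ (card_chains_le _ _ L.card_nbrs_le n e))
  rw [Finset.card_powerset, ← length_of_mem_chains hl]
  exact Nat.pow_le_pow_right two_pos (List.toFinset_card_le l)

theorem latticePoint_base_mem (e : L.graph.edgeSet) :
    latticePoint (L.base e).1 ∈ L.edgeSegment e := by
  obtain ⟨hx, hy, h⟩ := L.exists_eq_mkEdge_base e
  refine subset_convexHull ℝ _ ⟨⟨(L.base e).1, hx⟩, ?_, rfl⟩
  rw [congrArg Subtype.val h]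
  exact Sym2.mem_mk_left _ _

theorem setDist_le {A A' : Set (EuclideanSpace ℝ (Fin d))} {x y : EuclideanSpace ℝ (Fin d)}
    (hx : x ∈ A) (hy : y ∈ A') : setDist A A' ≤ dist x y :=
  csInf_le ⟨0, by rintro _ ⟨a, _, b, _, rfl⟩; exact dist_nonneg⟩ ⟨x, hx, y, hy, rfl⟩

open Classical in
/-- On the event that some cut edge is far from the other pivotal edges and from the outside, one
can open `m` edges along a chain of `2 m` steps without connecting `T` and `B`. -/
theorem exists_mem_chainSets (hd : 2 ≤ d) {T B : Set L.Vertex} (hT : T ⊆ L.boundary)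
    (hB : B ⊆ L.boundary) {r : ℝ} {m : ℕ} (hr : (d * (2 * m + 2) : ℝ) < r)
    {ω : FK.Config L.graph} (hω : ω ∈ FK.disconnection L.graph T B ∩ L.farCutEdge T B r) :
    ∃ Γ ∈ L.chainSets (2 * m), m ≤ Γ.card ∧ (∀ e ∈ Γ, ω e = false) ∧
      FK.openOn Γ ω ∈ FK.disconnection L.graph T B := by
  obtain ⟨hdis, C, ⟨hC, hclosed⟩, e, he, hfar⟩ := hω
  have hball : ∀ z : Fin d → ℤ, (∀ i, |z i - (L.base e).1 i| ≤ (2 * m : ℕ) + 2) →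
      latticePoint z ∈ L.cube := by
    intro z hz
    by_contra hout
    have h1 := setDist_le (L.latticePoint_base_mem e)
      (Set.mem_union_right (⋃ f ∈ FK.pivotalEdges T B ω \ {e}, L.edgeSegment f)
        (Set.mem_compl hout))
    have h2 := dist_latticePoint_le (m := 2 * m + 2) (by exact_mod_cast hz)
    rw [dist_comm] at h2
    push_cast at h2
    exact absurd (hfar.trans (h1.trans h2)) (not_le.2 hr)
  obtain ⟨f, p, hp, hlen⟩ := L.exists_isPath_star hd hT hB hC he (2 * m) hball
  have hcons := p.cons_tail_support
  have hnodup := hp.support_nodup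
  rw [← hcons, List.nodup_cons] at hnodup
  -- The first edge e may itself be pivotal, hence the tail. The other edges are within distance 2dm
  -- < r of e, too close to be pivotal.
  have hmem : ∀ g ∈ p.support.tail, g ∈ C ∧ g ∉ FK.pivotalEdges T B ω := by
    intro g hg
    have hgs : g ∈ p.support := List.mem_of_mem_tail hg
    refine ⟨L.star_mem he (p.takeUntil g hgs).reachable, fun hpiv => ?_⟩
    have hge : g ≠ e := by rintro rfl; exact hnodup.1 hg
    have h0 : ∀ i, |(L.base g).1 i - (L.base e).1 i| ≤ (2 * m : ℕ) := fun i =>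
      (L.abs_base_sub_le_length (p.takeUntil g hgs) i).trans (by
        rw [← hlen]; exact_mod_cast p.length_takeUntil_le_length hgs)
    have hg' : g ∈ FK.pivotalEdges T B ω \ {e} := ⟨hpiv, hge⟩
    have h1 := setDist_le (L.latticePoint_base_mem e) (Set.mem_union_left L.cubeᶜ
      (Set.mem_biUnion (t := L.edgeSegment) hg' (L.latticePoint_base_mem g)))
    have h2 := dist_latticePoint_le h0
    rw [dist_comm] at h2
    push_cast at h2
    have h3 : (d : ℝ) * (2 * m) ≤ d * (2 * m + 2) := by gcongr; linarith
    exact absurd (hfar.trans (h1.trans (h2.trans h3))) (not_le.2 hr)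
  have hcard : 2 * m ≤ p.support.tail.toFinset.card := by
    rw [List.toFinset_card_of_nodup hnodup.2, List.length_tail, p.length_support, hlen]
    simp
  obtain ⟨Γ, hΓ, hm, hΓdis⟩ := FK.exists_subset_openOn_not_connected hdis hcard
    fun g hg => (hmem g (List.mem_toFinset.1 hg)).2
  refine ⟨Γ, ?_, hm, fun g hg => hclosed g (hmem g (List.mem_toFinset.1 (hΓ hg))).1, hΓdis⟩
  refine Finset.mem_biUnion.2 ⟨e, Finset.mem_univ _, Finset.mem_biUnion.2
    ⟨p.support.tail, ?_, Finset.mem_powerset.2 hΓ⟩⟩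
  rw [← hlen]
  exact support_tail_mem_chains (H := L.star C) (fun a b hab => Finset.mem_filter.2
    ⟨Finset.mem_univ _, hab.2.2.2⟩) p

end Box

/-! ### Choice of the constants and conclusion -/

/-- Here Nd ≤ N² and exp(-m) ≤ N^(-3c), while 2 - 3c ≤ -c for c ≥ 1. -/
theorem mul_mul_exp_neg_le {N d : ℕ} {c : ℝ} {m : ℕ} (hc : 1 ≤ c) (hN : 0 < N) (hdN : d ≤ N)
    (hm : 3 * c * Real.log N ≤ m) :
    (N * d : ℝ) * Real.exp (-m) ≤ 1 / (N : ℝ) ^ c := by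
  have hN' : (0 : ℝ) < N := by exact_mod_cast hN
  have hlog : 0 ≤ Real.log N := Real.log_natCast_nonneg N
  have hexp : (N : ℝ) = Real.exp (Real.log N) := (Real.exp_log hN').symm
  have hdN' : (d : ℝ) ≤ N := by exact_mod_cast hdN
  calc (N * d : ℝ) * Real.exp (-m) ≤ (N * N : ℝ) * Real.exp (-m) := by gcongr
    _ = Real.exp (Real.log N + Real.log N + -m) := by
        rw [Real.exp_add, Real.exp_add, ← hexp]
    _ ≤ Real.exp (-(Real.log N * c)) := Real.exp_le_exp.2 (by nlinarith)
    _ = 1 / (N : ℝ) ^ c := by rw [Real.rpow_def_of_pos hN', Real.exp_neg, one_div]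

theorem mainTheorem4 (d : ℕ) (hd : 2 ≤ d) (q : ℝ) (hq : 1 ≤ q) :
    ∃ pt κ : ℝ, 0 < pt ∧ pt < 1 ∧ 1 < κ ∧
      ∀ p : ℝ, pt ≤ p → p ≤ 1 → ∀ c : ℝ, 1 ≤ c →
        ∀ L : Box d, 3 ^ (6 * d) < L.size →
          ∀ T B : Set L.Vertex, L.IsTopBottom T B →
            (ProbabilityTheory.cond (FK.fkMeasure L.graph T B p q)
                (FK.disconnection L.graph T B)).real
              (L.farCutEdge T B (κ * c * Real.log L.size)) ≤ 1 / (L.size : ℝ) ^ c := by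
  have hd' : (2 : ℝ) ≤ d := by exact_mod_cast hd
  have hDpos : (1 : ℝ) ≤ 3 ^ d * d := by
    exact_mod_cast Nat.mul_pos (pow_pos (by norm_num) d) (by omega)
  set D : ℝ := 3 ^ d * d with hD
  -- Each opened edge accounts for two chain steps, each costing D choices and a factor 2 for
  -- subsets; this ε leaves exp(-1) per opened edge.
  set ε : ℝ := (Real.exp 1 * (D * 2) ^ 2)⁻¹ with hε
  have hε0 : 0 < ε := by positivity
  have hε1 : ε ≤ 1 := by
    refine inv_le_one_of_one_le₀ ?_
    have h1 : (1 : ℝ) ≤ Real.exp 1 := Real.one_le_exp zero_le_one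
    have h2 : (1 : ℝ) ≤ (D * 2) ^ 2 := one_le_pow₀ (by linarith)
    nlinarith
  -- The first value is the threshold for (1 - p)q ≤ εp. For the second, with ℓ = ln|Λ| and cℓ ≥ 1,
  -- m ≤ 3cℓ + 1 ≤ 4cℓ gives 2m + 2 ≤ 10cℓ < 11cℓ.
  refine ⟨q / (q + ε), 11 * d, by positivity, (div_lt_one (by positivity)).2 (by linarith),
    by linarith, ?_⟩
  intro p hp hp1 c hc L hL T B hTB
  have hp0 : 0 ≤ p := le_trans (by positivity) hp
  have hpε : (1 - p) * q ≤ ε * p := by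
    rw [div_le_iff₀ (by positivity)] at hp
    linarith
  have hdN : d ≤ L.size := by
    have h1 : d < 3 ^ d := Nat.lt_pow_self (by norm_num)
    have h2 : 3 ^ d ≤ 3 ^ (6 * d) := Nat.pow_le_pow_right (by norm_num) (by omega)
    omega
  have hlog : 1 ≤ Real.log L.size := by
    have h1 : 3 ^ 1 ≤ 3 ^ (6 * d) := Nat.pow_le_pow_right (by norm_num) (by omega)
    have h2 : (3 : ℝ) ≤ L.size := by exact_mod_cast (by omega : 3 ≤ L.size)
    rw [Real.le_log_iff_exp_le (by linarith)]
    linarith [Real.exp_one_lt_d9]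
  set ℓ := Real.log L.size
  have hcl : 1 ≤ c * ℓ := one_le_mul_of_one_le_of_one_le hc hlog
  obtain ⟨m, hm, hm'⟩ : ∃ m : ℕ, 3 * c * ℓ ≤ m ∧ (m : ℝ) ≤ 4 * (c * ℓ) :=
    ⟨⌈3 * c * ℓ⌉₊, Nat.le_ceil _, by
      have := Nat.ceil_lt_add_one (a := 3 * c * ℓ) (by nlinarith)
      linarith⟩
  have hr : (d * (2 * m + 2) : ℝ) < 11 * d * c * ℓ := by
    have h1 : (2 * m + 2 : ℝ) < 11 * (c * ℓ) := by linarith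
    calc (d * (2 * m + 2) : ℝ) < d * (11 * (c * ℓ)) := by gcongr
      _ = 11 * d * c * ℓ := by ring
  have hb : (L.chainSets (2 * m)).card * ε ^ m ≤ 1 / (L.size : ℝ) ^ c := by
    have h1 : ((L.chainSets (2 * m)).card : ℝ) ≤
        L.size * d * (D ^ (2 * m) * 2 ^ (2 * m)) := by
      rw [hD]; exact_mod_cast L.card_chainSets_le (2 * m)
    refine le_trans ?_ (mul_mul_exp_neg_le hc (by omega) hdN hm)
    calc (L.chainSets (2 * m)).card * ε ^ m
        ≤ L.size * d * (D ^ (2 * m) * 2 ^ (2 * m)) * ε ^ m := by gcongr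
      _ = L.size * d * ((D * 2) ^ 2 * ε) ^ m := by
          rw [← mul_pow, pow_mul, mul_pow ((D * 2) ^ 2)]; ring
      _ = L.size * d * Real.exp (-m) := by
          have h2 : (D * 2) ^ 2 * ε = Real.exp (-1) := by
            rw [hε, Real.exp_neg, mul_inv]
            field_simp
          rw [h2, ← Real.exp_nat_mul]
          simp
  refine FK.cond_fkMeasure_real_le T B hp0 hp1 (by linarith) (by positivity) _ _ ?_
  refine le_of_eq_of_le (Finset.sum_congr (by ext; simp) fun _ _ => rfl)
    ((FK.sum_weight_le T B hp0 hp1 hq hε0.le hε1 hpε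
    (FK.disconnection L.graph T B ∩ L.farCutEdge T B (11 * d * c * ℓ))
    (FK.disconnection L.graph T B) (L.chainSets (2 * m)) m fun ω hω => ?_).trans
    (mul_le_mul_of_nonneg_right hb (Finset.sum_nonneg fun ω _ =>
      FK.weight_nonneg T B hp0 hp1 (by linarith) ω)))
  exact L.exists_mem_chainSets hd hTB.2.1 hTB.2.2.1 hr hω
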